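/- \textbf{Theorem.} Let $W$ be a finite Coxeter group of rank $n$ acting on $\mathbb{R}^n$: that is, $W$ is a finite subgroup of the orthogonal group $O(n)$ with a Coxeter presentation \[ W = \langle s_1,\dots,s_n \mid (s_i s_j)^{m(i,j)} = 1 \rangle, \qquad m(i,i)=1,\quad m(i,j)=m(j,i)\ge 2 \ (i\neq j), \] on a set $S=\{s_1,\dots,s_n\}$ of $n$ generators (the simple reflections), each of which is the orthogonal reflection of $\mathbb{R}^n$ in a hyperplane $H_i$ through the origin. For each $i$ let $H_i^{+}$ be one of the two open half-spaces bounded by $H_i$, chosen arbitrarily. For $I\subseteq S$ let \[ C_I=\bigcap_{s_i\in I} H_i\ \cap \bigcap_{s_i\notin I} H_i^{+}, \] and let $W_I=\langle I\rangle$ be the standard parabolic subgroup of $W$ generated by the elements of $I$. If $|I|=n-1$, then the stabiliser of $C_I$ in $W$ is exactly the standard parabolic subgroup: \[ \{\,w\in W : w(C_I)=C_I\,\} = \langle I\rangle = W_I . \] -/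

import Mathlib

/-- The orthogonal group of Euclidean `n`-space: linear isometries of `ℝⁿ` onto itself. -/
abbrev OrthGroup (n : ℕ) : Type :=
  EuclideanSpace ℝ (Fin n) ≃ₗᵢ[ℝ] EuclideanSpace ℝ (Fin n)

/-- The hyperplane through the origin with normal vector `a` (a hyperplane when `a ≠ 0`). -/
noncomputable def mirror {n : ℕ} (a : EuclideanSpace ℝ (Fin n)) : Submodule ℝ (EuclideanSpace ℝ (Fin n)) :=
  (Submodule.span ℝ {a})ᗮ

/-- The reflection that negates `a` and fixes the hyperplane `mirror a` pointwise. -/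
noncomputable def mirrorReflection {n : ℕ} (a : EuclideanSpace ℝ (Fin n)) : OrthGroup n :=
  (Submodule.span ℝ {a})ᗮ.reflection

/-- The open half-space bounded by `mirror a`, on the side to which `a` points. -/
noncomputable def posHalfSpace {n : ℕ} (a : EuclideanSpace ℝ (Fin n)) : Set (EuclideanSpace ℝ (Fin n)) :=
  {x | 0 < inner ℝ a x}

/-- A finite Coxeter group of rank `n` acting on `ℝⁿ`: a finite subgroup `W` of the orthogonal
group with a Coxeter presentation on `n` generators (the simple reflections) `s i`, each of which
is a reflection of `ℝⁿ`. The vector `normal i` is a normal of the mirror of `s i`;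
its direction records which side of the mirror is called positive, and this choice is free. -/
structure FiniteCoxeterReflectionGroup (n : ℕ) where
  /-- The group. -/
  W : Subgroup (OrthGroup n)
  finite : Finite W
  /-- The orders `m(i, j)`. -/
  M : CoxeterMatrix (Fin n)
  /-- The presentation `⟨s i | (s i * s j) ^ m(i, j) = 1⟩` of `W`. -/
  cs : CoxeterSystem M W
  /-- Normal vectors of the mirrors. -/
  normal : Fin n → EuclideanSpace ℝ (Fin n)
  normal_ne_zero : ∀ i, normal i ≠ 0
  simple_eq : ∀ i, (cs.simple i : OrthGroup n) = mirrorReflection (normal i)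

namespace FiniteCoxeterReflectionGroup

variable {n : ℕ} (G : FiniteCoxeterReflectionGroup n)

open Classical in
/-- The facet `C_I`: the intersection over all `i` of the mirror `H_i` if `i ∈ I`, and of the
positive open half-space `H_i⁺` if `i ∉ I`. -/
noncomputable def facet (I : Finset (Fin n)) : Set (EuclideanSpace ℝ (Fin n)) :=
  ⋂ i, if i ∈ I then (mirror (G.normal i) : Set (EuclideanSpace ℝ (Fin n)))
    else posHalfSpace (G.normal i)

/-- The standard parabolic subgroup `W_I`, generated by the simple reflections `s i`, `i ∈ I`. -/
noncomputable def parabolic (I : Finset (Fin n)) : Subgroup G.W :=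
  Subgroup.closure (G.cs.simple '' (I : Set (Fin n)))

/-- The (setwise) stabiliser in `W` of a subset of `ℝⁿ`. -/
noncomputable def stab (C : Set (EuclideanSpace ℝ (Fin n))) : Subgroup G.W where
  carrier := {w | (w : OrthGroup n) '' C = C}
  one_mem' := by simp
  mul_mem' := by
    intro u v hu hv
    have hu' : (u : OrthGroup n) '' C = C := hu
    have hv' : (v : OrthGroup n) '' C = C := hv
    have h : ((u * v : G.W) : OrthGroup n) '' C
        = (u : OrthGroup n) '' ((v : OrthGroup n) '' C) := by
      rw [Set.image_image]; rfl
    change ((u * v : G.W) : OrthGroup n) '' C = C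
    rw [h, hv', hu']
  inv_mem' := by
    intro u hu
    have hu' : (u : OrthGroup n) '' C = C := hu
    change ((u⁻¹ : G.W) : OrthGroup n) '' C = C
    conv_lhs => rw [← hu']
    rw [Set.image_image]
    have : ∀ x, ((u⁻¹ : G.W) : OrthGroup n) ((u : OrthGroup n) x) = x :=
      fun x => (u : OrthGroup n).symm_apply_apply x
    simp only [this, Set.image_id']

end FiniteCoxeterReflectionGroup

/-- Coefficients of the roots in the orbit of a simple root under a rank two standard parabolic
subgroup. -/
theorem exists_dihedral_coefficients (m : ℕ) (hm : m ≠ 1) :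
    ∃ a : ℕ → ℝ, a 0 = 0 ∧ a 1 = 1 ∧
      (∀ k, a (k + 2) = 2 * Real.cos (Real.pi / m) * a (k + 1) - a k) ∧
      ∀ k, (m = 0 ∨ k ≤ m) → 0 ≤ a k := by
  rcases Nat.eq_zero_or_pos m with rfl | hpos
  · refine ⟨fun k => k, by simp, by simp, fun k => ?_, fun k _ => by positivity⟩
    simp only [Nat.cast_zero, div_zero, Real.cos_zero]
    push_cast
    ring
  · have hm2 : (2 : ℝ) ≤ m := by exact_mod_cast (by omega : 2 ≤ m)
    have hm0 : (0 : ℝ) < m := by linarith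
    have hs : 0 < Real.sin (Real.pi / m) := by
      apply Real.sin_pos_of_pos_of_lt_pi (by positivity)
      rw [div_lt_iff₀ hm0]
      nlinarith [Real.pi_pos]
    refine ⟨fun k => Real.sin (k * (Real.pi / m)) / Real.sin (Real.pi / m), by simp, ?_,
      fun k => ?_, fun k hk => ?_⟩
    · simp [hs.ne']
    · have h1 := Real.sin_add ((k + 1 : ℝ) * (Real.pi / m)) (Real.pi / m)
      have h2 := Real.sin_sub ((k + 1 : ℝ) * (Real.pi / m)) (Real.pi / m)
      have e1 : ((k + 1 : ℝ) * (Real.pi / m)) + (Real.pi / m) = (k + 2) * (Real.pi / m) := by ring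
      have e2 : ((k + 1 : ℝ) * (Real.pi / m)) - (Real.pi / m) = k * (Real.pi / m) := by ring
      rw [e1] at h1
      rw [e2] at h2
      push_cast
      field_simp
      field_simp at h1 h2
      linarith
    · have hk' : (k : ℝ) ≤ m := by
        rcases hk with h | h
        · omega
        · exact_mod_cast h
      refine div_nonneg (Real.sin_nonneg_of_nonneg_of_le_pi (by positivity) ?_) hs.le
      rw [mul_div_assoc', div_le_iff₀ hm0]
      nlinarith [Real.pi_pos]

/-- A product of two reflections whose Cartan numbers are those of the angle `π / m` has order
dividing `m`. -/
theorem Module.reflection_mul_reflection_pow_eq_one {E : Type*} [AddCommGroup E] [Module ℝ E]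
    {x y : E} {f g : Module.Dual ℝ E} (hf : f x = 2) (hg : g y = 2) {m : ℕ} (hm : m ≠ 1)
    (hfy : f y = -2 * Real.cos (Real.pi / m)) (hgx : g x = -2 * Real.cos (Real.pi / m)) :
    (Module.reflection hf * Module.reflection hg) ^ m = 1 := by
  rcases Nat.eq_zero_or_pos m with rfl | hpos
  · simp
  ext z
  rw [Module.reflection_mul_reflection_pow_apply hf hg m z]
  rcases eq_or_ne m 2 with rfl | hm2
  · have h0 : Real.cos (Real.pi / (2 : ℕ)) = 0 := by
      push_cast
      exact Real.cos_pi_div_two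
    rw [hfy, hgx, h0]
    norm_num
    abel
  have hm3 : (3 : ℝ) ≤ m := by exact_mod_cast (by omega : 3 ≤ m)
  have hm0 : (0 : ℝ) < m := by linarith
  set θ := Real.pi / m with hθ
  have hmθ : m * θ = Real.pi := by
    rw [hθ]
    field_simp
  have hs : Real.sin (2 * θ) ≠ 0 := by
    have hθ0 : 0 < θ := by positivity
    refine (Real.sin_pos_of_pos_of_lt_pi (by linarith) ?_).ne'
    nlinarith
  have ht : f y * g x - 2 = 2 * Real.cos (2 * θ) := by
    rw [hfy, hgx, Real.cos_two_mul]
    ring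
  rw [ht]
  have key := Polynomial.Chebyshev.S_two_mul_real_cos (2 * θ)
  rcases Nat.even_or_odd' m with ⟨k, hk | hk⟩
  · have e1 : ((m : ℤ) - 2) / 2 = k - 1 := by omega
    have e2 : ((m : ℤ) - 1) / 2 = k - 1 := by omega
    have h0 : (Polynomial.Chebyshev.S ℝ ((k : ℤ) - 1)).eval (2 * Real.cos (2 * θ)) = 0 := by
      have := key ((k : ℤ) - 1)
      have e : (((k : ℤ) - 1 : ℤ) + 1 : ℝ) * (2 * θ) = Real.pi := by
        rw [← hmθ, hk]
        push_cast
        ring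
      rw [e, Real.sin_pi] at this
      exact (mul_eq_zero.mp this).resolve_right hs
    rw [e1, e2, h0]
    simp
  · have e1 : ((m : ℤ) - 2) / 2 = k - 1 := by omega
    have e2 : ((m : ℤ) - 1) / 2 = k := by omega
    have e3 : ((m : ℤ) - 3) / 2 = k - 1 := by omega
    have e4 : (m : ℤ) / 2 = k := by omega
    have h0 : (Polynomial.Chebyshev.S ℝ (k : ℤ)).eval (2 * Real.cos (2 * θ)) +
        (Polynomial.Chebyshev.S ℝ ((k : ℤ) - 1)).eval (2 * Real.cos (2 * θ)) = 0 := by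
      refine (mul_eq_zero.mp (?_ : _ * Real.sin (2 * θ) = 0)).resolve_right hs
      rw [add_mul, key, key]
      have h1 : (((k : ℤ) : ℝ) + 1) * (2 * θ) = Real.pi + θ := by
        rw [← hmθ, hk]
        push_cast
        ring
      have h2 : ((((k : ℤ) - 1 : ℤ) : ℝ) + 1) * (2 * θ) = Real.pi - θ := by
        rw [← hmθ, hk]
        push_cast
        ring
      rw [h1, h2, Real.sin_pi_sub, add_comm, add_comm Real.pi, Real.sin_add_pi]
      ring
    rw [e1, e2, e3, e4, h0]
    simp

namespace CoxeterMatrix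

variable {ι : Type*} [Fintype ι] [DecidableEq ι] (M : CoxeterMatrix ι)

/-- The linear form `v ↦ B(α i, v)`, where `B` is the standard bilinear form of `M`. -/
noncomputable def geomForm (i : ι) : (ι → ℝ) →ₗ[ℝ] ℝ :=
  ∑ j, (-Real.cos (Real.pi / M i j)) • LinearMap.proj j

omit [DecidableEq ι] in
theorem geomForm_apply (i : ι) (v : ι → ℝ) :
    M.geomForm i v = ∑ j, -Real.cos (Real.pi / M i j) * v j := by
  simp [geomForm]

theorem geomForm_single (i j : ι) :
    M.geomForm i (Pi.single j 1) = -Real.cos (Real.pi / M i j) := by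
  rw [geomForm_apply, Finset.sum_eq_single j] <;> simp +contextual

theorem geomForm_single_self (i : ι) : M.geomForm i (Pi.single i 1) = 1 := by
  simp [geomForm_single]

theorem two_smul_geomForm_single_self (i : ι) : (2 • M.geomForm i) (Pi.single i 1) = 2 := by
  simp [geomForm_single_self]

omit [DecidableEq ι] in
theorem sum_mul_geomForm_comm (u v : ι → ℝ) :
    ∑ i, u i * M.geomForm i v = ∑ i, v i * M.geomForm i u := by
  simp only [geomForm_apply, Finset.mul_sum]
  rw [Finset.sum_comm]
  refine Finset.sum_congr rfl fun j _ => Finset.sum_congr rfl fun i _ => ?_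
  rw [M.symmetric i j]
  ring

theorem isLiftable_geomReflection :
    M.IsLiftable fun i => Module.reflection (M.two_smul_geomForm_single_self i) := by
  intro i j
  rcases eq_or_ne i j with rfl | hij
  · rw [M.diagonal, pow_one]
    ext1 v
    exact Module.involutive_reflection _ v
  · refine Module.reflection_mul_reflection_pow_eq_one _ _ (M.off_diagonal i j hij) ?_ ?_
    · rw [LinearMap.smul_apply, geomForm_single]
      simp
    · rw [LinearMap.smul_apply, geomForm_single, M.symmetric j i]
      simp

end CoxeterMatrix

namespace CoxeterSystem

variable {ι : Type*} [Fintype ι] [DecidableEq ι] {M : CoxeterMatrix ι} {W : Type*} [Group W]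
  (cs : CoxeterSystem M W)

/-- The geometric representation of a Coxeter group. -/
noncomputable def geomRep : W →* ((ι → ℝ) ≃ₗ[ℝ] (ι → ℝ)) :=
  cs.lift ⟨_, M.isLiftable_geomReflection⟩

theorem geomRep_simple (i : ι) (v : ι → ℝ) :
    cs.geomRep (cs.simple i) v = v - (2 * M.geomForm i v) • Pi.single i 1 := by
  rw [geomRep, lift_apply_simple, Module.reflection_apply]
  simp

theorem geomRep_alternatingWord {i j : ι} {a : ℕ → ℝ} (h0 : a 0 = 0) (h1 : a 1 = 1)
    (ha : ∀ k, a (k + 2) = 2 * Real.cos (Real.pi / M i j) * a (k + 1) - a k) (k : ℕ) :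
    cs.geomRep (cs.wordProd (alternatingWord i j k)) (Pi.single i 1) =
      if Even k then a (k + 1) • Pi.single i 1 + a k • Pi.single j 1
      else a k • Pi.single i 1 + a (k + 1) • Pi.single j 1 := by
  induction k with
  | zero => simp [alternatingWord, h0, h1]
  | succ k ih =>
    rw [alternatingWord_succ', wordProd_cons, map_mul, LinearEquiv.mul_apply, ih]
    by_cases hk : Even k
    · have hk' : ¬ Even (k + 1) := by simp [hk, parity_simps]
      simp only [hk, hk', if_true, if_false, geomRep_simple, map_add, map_smul,
        CoxeterMatrix.geomForm_single, M.diagonal, M.symmetric j i, ha]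
      rw [Nat.cast_one, div_one, Real.cos_pi]
      module
    · have hk' : Even (k + 1) := by simp [hk, parity_simps]
      simp only [hk, hk', if_true, if_false, geomRep_simple, map_add, map_smul,
        CoxeterMatrix.geomForm_single, M.diagonal, ha]
      rw [Nat.cast_one, div_one, Real.cos_pi]
      module

theorem geomRep_alternatingWord_nonneg {i j : ι} (hij : i ≠ j) {k : ℕ}
    (hk : M i j = 0 ∨ k < M i j) :
    ∃ p q : ℝ, 0 ≤ p ∧ 0 ≤ q ∧
      cs.geomRep (cs.wordProd (alternatingWord i j k)) (Pi.single i 1) =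
        p • Pi.single i 1 + q • Pi.single j 1 := by
  obtain ⟨a, h0, h1, ha, hnn⟩ := exists_dihedral_coefficients (M i j) (M.off_diagonal i j hij)
  have n1 := hnn k (by omega)
  have n2 := hnn (k + 1) (by omega)
  rw [cs.geomRep_alternatingWord h0 h1 ha]
  split_ifs
  · exact ⟨_, _, n2, n1, rfl⟩
  · exact ⟨_, _, n1, n2, rfl⟩

omit [Fintype ι] [DecidableEq ι] in
theorem length_wordProd_alternatingWord_mul_simple_lt {i j : ι} {k : ℕ} (hM : M i j ≠ 0)
    (hk : M i j ≤ k) :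
    ∃ ω : List ι, ω.length + 1 = k ∧
      cs.wordProd (alternatingWord i j k) * cs.simple i = cs.wordProd ω := by
  have suffix : ∀ d : ℕ, ∃ ω : List ι, ω.length = d ∧
      alternatingWord i j (M i j + d) = ω ++ alternatingWord i j (M i j) := by
    intro d
    induction d with
    | zero => exact ⟨[], rfl, rfl⟩
    | succ d ih =>
      obtain ⟨ω, hω, h⟩ := ih
      refine ⟨(if Even (M i j + d) then j else i) :: ω, by simp [hω], ?_⟩
      rw [← add_assoc, alternatingWord_succ', h, List.cons_append]
  obtain ⟨ω, hω, h⟩ := suffix (k - M i j)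
  rw [Nat.add_sub_cancel' hk] at h
  obtain ⟨m, hm⟩ := Nat.exists_eq_succ_of_ne_zero hM
  refine ⟨ω ++ alternatingWord i j m, ?_, ?_⟩
  · simp only [List.length_append, hω, length_alternatingWord]
    omega
  · have hb := cs.wordProd_braidWord_eq i j
    rw [braidWord, braidWord, M.symmetric j i, hm, Nat.succ_eq_add_one,
      alternatingWord_succ j i, wordProd_concat] at hb
    rw [h, wordProd_append, hm, Nat.succ_eq_add_one, hb, wordProd_append, mul_assoc, mul_assoc,
      simple_mul_simple_self, mul_one]

/-- A right ascent of `w` corresponds to a simple root that `w` maps to a positive root. -/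
theorem geomRep_single_nonneg (w : W) (i : ι) (hi : ¬ cs.IsRightDescent w i) :
    0 ≤ cs.geomRep w (Pi.single i 1) := by
  induction hl : cs.length w using Nat.strong_induction_on generalizing w i with
  | _ l ih =>
  subst hl
  rcases eq_or_ne w 1 with rfl | hw
  · simp [Pi.single_nonneg]
  obtain ⟨j, hj⟩ := cs.exists_rightDescent_of_ne_one hw
  have hij : i ≠ j := by
    rintro rfl
    exact hi hj
  let P : ℕ → Prop := fun k => ∃ v, w = v * cs.wordProd (alternatingWord i j k) ∧
    cs.length w = cs.length v + k
  have hP1 : P 1 := by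
    refine ⟨w * cs.simple j, by simp [alternatingWord], ?_⟩
    exact (cs.isRightDescent_iff.mp hj).symm
  have hbound : ∀ k, P k → k ≤ cs.length w := by
    rintro k ⟨v, -, hv⟩
    omega
  classical
  let k := Nat.findGreatest P (cs.length w)
  have hk1 : 1 ≤ k := Nat.le_findGreatest (hbound 1 hP1) hP1
  have hPk : P k := Nat.findGreatest_spec (hbound 1 hP1) hP1
  have hPk' : ¬ P (k + 1) := fun h => by
    have := Nat.le_findGreatest (hbound _ h) h
    change k + 1 ≤ k at this
    omega
  obtain ⟨v, hv, hvl⟩ := hPk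
  obtain ⟨k', hk'⟩ : ∃ k', k = k' + 1 := ⟨k - 1, by omega⟩
  have first : ∀ r, r = (if Even k' then j else i) → ¬ cs.IsRightDescent v r := by
    intro r hr hd
    have e : w = v * cs.simple r * cs.wordProd (alternatingWord i j k') := by
      rw [hv, hk', alternatingWord_succ', wordProd_cons, ← hr, mul_assoc]
    have h1 := cs.length_mul_le (v * cs.simple r) (cs.wordProd (alternatingWord i j k'))
    rw [← e] at h1
    have h2 := cs.length_wordProd_le (alternatingWord i j k')
    rw [length_alternatingWord] at h2
    have h3 := cs.isRightDescent_iff.mp hd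
    omega
  have second : ∀ r, r = (if Even k then j else i) → ¬ cs.IsRightDescent v r := by
    intro r hr hd
    refine hPk' ⟨v * cs.simple r, ?_, ?_⟩
    · rw [alternatingWord_succ', wordProd_cons, ← hr, mul_assoc,
        simple_mul_simple_cancel_left, hv]
    · have h3 := cs.isRightDescent_iff.mp hd
      omega
  have hvij : ¬ cs.IsRightDescent v i ∧ ¬ cs.IsRightDescent v j := by
    by_cases he : Even k'
    · have he' : ¬ Even k := by simp [hk', he, parity_simps]
      exact ⟨second i (by simp [he']), first j (by simp [he])⟩
    · have he' : Even k := by simp [hk', he, parity_simps]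
      exact ⟨first i (by simp [he]), second j (by simp [he'])⟩
  have hkM : M i j = 0 ∨ k < M i j := by
    by_contra! hcon
    obtain ⟨ω, hω, h⟩ := cs.length_wordProd_alternatingWord_mul_simple_lt hcon.1 hcon.2
    apply hi
    rw [IsRightDescent]
    have e : w * cs.simple i = v * cs.wordProd ω := by rw [hv, mul_assoc, h]
    rw [e]
    have h1 := cs.length_mul_le v (cs.wordProd ω)
    have h2 := cs.length_wordProd_le ω
    omega
  obtain ⟨p, q, hp, hq, hpq⟩ := cs.geomRep_alternatingWord_nonneg hij hkM
  rw [hv, map_mul, LinearEquiv.mul_apply, hpq, map_add, map_smul, map_smul]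
  exact add_nonneg (smul_nonneg hp (ih _ (by omega) v i hvij.1 rfl))
    (smul_nonneg hq (ih _ (by omega) v j hvij.2 rfl))

theorem geomRep_single_nonpos (w : W) (i : ι) (hi : cs.IsRightDescent w i) :
    cs.geomRep w (Pi.single i 1) ≤ 0 := by
  have h := cs.geomRep_single_nonneg (w * cs.simple i) i
    (cs.isRightDescent_iff_not_isRightDescent_mul.mp hi)
  rw [map_mul, LinearEquiv.mul_apply, geomRep_simple, M.geomForm_single_self] at h
  have e : (Pi.single i 1 - (2 * 1 : ℝ) • Pi.single i 1 : ι → ℝ) = -Pi.single i 1 := by module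
  rw [e, map_neg] at h
  exact neg_nonneg.mp h

/-- The stabiliser of a fundamental weight is a maximal standard parabolic subgroup. -/
theorem mem_closure_of_geomRep_apply_eq (j : ι) (w : W)
    (hw : ∀ v, cs.geomRep w v j = v j) :
    w ∈ Subgroup.closure (cs.simple '' {i | i ≠ j}) := by
  induction hl : cs.length w using Nat.strong_induction_on generalizing w with
  | _ l ih =>
  subst hl
  rcases eq_or_ne w 1 with rfl | hne
  · exact one_mem _
  obtain ⟨i, hi⟩ := cs.exists_rightDescent_of_ne_one hne
  have hij : i ≠ j := by
    rintro rfl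
    have h1 := cs.geomRep_single_nonpos w i hi i
    rw [hw] at h1
    simp at h1
    linarith
  have hmem : cs.simple i ∈ Subgroup.closure (cs.simple '' {i | i ≠ j}) :=
    Subgroup.subset_closure ⟨i, hij, rfl⟩
  rw [← cs.simple_mul_simple_cancel_right (w := w) i]
  refine mul_mem (ih _ hi (w * cs.simple i) (fun v => ?_) rfl) hmem
  rw [map_mul, LinearEquiv.mul_apply, hw, geomRep_simple]
  simp [hij.symm]

theorem sum_mul_geomForm_geomRep (w : W) (u v : ι → ℝ) :
    ∑ i, cs.geomRep w u i * M.geomForm i (cs.geomRep w v) = ∑ i, u i * M.geomForm i v := by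
  induction w using cs.simple_induction_left generalizing u v with
  | one => simp
  | mul_simple_left w k ih =>
    rw [map_mul, LinearEquiv.mul_apply, LinearEquiv.mul_apply, ← ih u v]
    generalize cs.geomRep w u = u
    generalize cs.geomRep w v = v
    have single : ∀ (x : ι → ℝ), ∑ i, (Pi.single k 1 : ι → ℝ) i * M.geomForm i x =
        M.geomForm k x := fun x => by
      rw [Finset.sum_eq_single k] <;> simp +contextual
    have single' : ∀ (x : ι → ℝ), ∑ i, x i * M.geomForm i (Pi.single k 1) =
        M.geomForm k x := fun x => by
      rw [M.sum_mul_geomForm_comm, single]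
    have expand : ∀ (a b : ℝ), ∑ i, (u - a • Pi.single k 1 : ι → ℝ) i *
        M.geomForm i (v - b • Pi.single k 1) =
        ∑ i, u i * M.geomForm i v - b * ∑ i, u i * M.geomForm i (Pi.single k 1) -
        a * ∑ i, (Pi.single k 1 : ι → ℝ) i * M.geomForm i v +
        a * b * ∑ i, (Pi.single k 1 : ι → ℝ) i * M.geomForm i (Pi.single k 1) := by
      intro a b
      simp only [Finset.mul_sum, ← Finset.sum_sub_distrib, ← Finset.sum_add_distrib]
      refine Finset.sum_congr rfl fun i _ => ?_
      simp only [map_sub, map_smul, Pi.sub_apply, Pi.smul_apply, smul_eq_mul]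
      ring
    rw [geomRep_simple, geomRep_simple, expand, single, single, single', M.geomForm_single_self]
    ring

/-- The standard bilinear form of a finite Coxeter group is nondegenerate. -/
theorem eq_zero_of_geomForm_eq_zero (cs : CoxeterSystem M W) [Finite W] (v : ι → ℝ) (hv : ∀ i, M.geomForm i v = 0) :
    v = 0 := by
  have := Fintype.ofFinite W
  have hfix : ∀ w, cs.geomRep w v = v := by
    intro w
    induction w using cs.simple_induction_left with
    | one => simp
    | mul_simple_left w k ih =>
      rw [map_mul, LinearEquiv.mul_apply, ih, geomRep_simple, hv]
      simp
  funext j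
  let F : (ι → ℝ) →ₗ[ℝ] ℝ := ∑ w : W, (LinearMap.proj j).comp (cs.geomRep w).toLinearMap
  have hF : ∀ u, F u = ∑ w : W, cs.geomRep w u j := fun u => by simp [F]
  have hinv : ∀ k u, F (cs.geomRep (cs.simple k) u) = F u := by
    intro k u
    rw [hF, hF]
    exact Fintype.sum_equiv (Equiv.mulRight (cs.simple k)) _ _ fun w => by simp
  have hsingle : ∀ k, F (Pi.single k 1) = 0 := by
    intro k
    have h := hinv k (Pi.single k 1)
    rw [geomRep_simple, M.geomForm_single_self, map_sub, map_smul, smul_eq_mul] at h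
    linarith
  have hzero : F = 0 := by
    refine LinearMap.pi_ext' fun k => LinearMap.ext_ring ?_
    simpa using hsingle k
  have h := hF v
  rw [hzero] at h
  simp only [hfix, LinearMap.zero_apply, Finset.sum_const, Finset.card_univ, nsmul_eq_mul] at h
  have hc : (Fintype.card W : ℝ) ≠ 0 := by exact_mod_cast Fintype.card_ne_zero
  simpa [hc] using h.symm

end CoxeterSystem

section ReflectionGroup

variable {E : Type*} [NormedAddCommGroup E] [InnerProductSpace ℝ E]

/-- The reflection in the hyperplane orthogonal to `a`. -/
noncomputable abbrev orthReflection (a : E) : E ≃ₗᵢ[ℝ] E := (Submodule.span ℝ {a})ᗮ.reflection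

theorem orthReflection_apply (a v : E) :
    orthReflection a v = v - (2 * (inner ℝ a v / ‖a‖ ^ 2)) • a := by
  rw [orthReflection, Submodule.reflection_orthogonal_apply, Submodule.reflection_singleton_apply]
  simp only [RCLike.ofReal_real_eq_id, id]
  module

theorem orthReflection_apply_of_norm_eq_one {a : E} (ha : ‖a‖ = 1) (v : E) :
    orthReflection a v = v - (2 * inner ℝ a v) • a := by
  simp [orthReflection_apply, ha]

theorem orthReflection_apply_eq_self_iff {a v : E} : orthReflection a v = v ↔ inner ℝ a v = 0 := by
  rw [orthReflection, Submodule.reflection_eq_self_iff,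
    Submodule.mem_orthogonal_singleton_iff_inner_right]

theorem orthReflection_mul_self (a : E) : orthReflection a * orthReflection a = 1 :=
  Submodule.reflection_mul_reflection _

theorem orthReflection_smul {c : ℝ} (hc : c ≠ 0) (a : E) :
    orthReflection (c • a) = orthReflection a := by
  have : Submodule.span ℝ {c • a} = Submodule.span ℝ {a} :=
    Submodule.span_singleton_smul_eq hc.isUnit a
  ext v
  simp only [orthReflection, this]

theorem orthReflection_map (u : E ≃ₗᵢ[ℝ] E) (a : E) :
    orthReflection (u a) = u * orthReflection a * u⁻¹ := by
  ext v
  have h : inner ℝ (u a) v = inner ℝ a (u⁻¹ v) := by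
    rw [← u.inner_map_map a (u⁻¹ v)]
    congr 1
    exact (u.apply_symm_apply v).symm
  change _ = u (orthReflection a (u⁻¹ v))
  rw [orthReflection_apply, orthReflection_apply, u.norm_map, h, map_sub, map_smul]
  congr 1
  exact (u.apply_symm_apply v).symm

open Classical in
/-- A minimal subset of a finite set of vectors in an open half-space that spans the same
convex cone. -/
theorem exists_minimal_cone_generators (P : Finset E) :
    ∃ D ⊆ P, (∀ b ∈ P, ∃ c : E → ℝ, (∀ d ∈ D, 0 ≤ c d) ∧ b = ∑ d ∈ D, c d • d) ∧
      ∀ a ∈ D, ∀ c : E → ℝ, (∀ d ∈ D, 0 ≤ c d) → ∑ d ∈ D with d ≠ a, c d • d ≠ a := by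
  obtain ⟨D, hD⟩ := exists_minimal_of_wellFoundedLT (fun D : Finset E => D ⊆ P ∧
    ∀ b ∈ P, ∃ c : E → ℝ, (∀ d ∈ D, 0 ≤ c d) ∧ b = ∑ d ∈ D, c d • d)
    ⟨P, Finset.Subset.refl P, fun b hb => ⟨Pi.single b 1, fun d _ => by
      rw [Pi.single_apply]
      split_ifs <;> norm_num, by simp [Pi.single_apply, hb]⟩⟩
  refine ⟨D, hD.prop.1, hD.prop.2, fun a ha c hc hca => ?_⟩
  have hle := hD.le_of_le (y := D.filter (· ≠ a)) ⟨(Finset.filter_subset _ _).trans hD.prop.1, ?_⟩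
    (Finset.filter_subset _ _)
  · simpa using hle ha
  · intro b hb
    obtain ⟨e, he, hbe⟩ := hD.prop.2 b hb
    refine ⟨fun d => e a * c d + e d, fun d hd => ?_, ?_⟩
    · have hd' := (Finset.mem_filter.mp hd).1
      exact add_nonneg (mul_nonneg (he a ha) (hc d hd')) (he d hd')
    · simp only [add_smul, mul_smul, Finset.sum_add_distrib, ← Finset.smul_sum, hca]
      rw [hbe, Finset.filter_ne', Finset.add_sum_erase D (fun d => e d • d) ha]

/-- A finite, reflection-closed set of unit vectors. -/
structure IsUnitRootSystem (Φ : Set E) : Prop where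
  finite : Φ.Finite
  norm_eq_one : ∀ a ∈ Φ, ‖a‖ = 1
  reflection_mem : ∀ a ∈ Φ, ∀ b ∈ Φ, orthReflection a b ∈ Φ

/-- Simple roots for the positive system determined by the point `x`, characterised by the
properties used in the theory of lengths. -/
structure IsSimpleSystem (Φ : Set E) (x : E) (D : Set E) : Prop where
  subset : D ⊆ Φ
  pos : ∀ a ∈ D, 0 < inner ℝ a x
  permutes : ∀ a ∈ D, ∀ b ∈ Φ, 0 < inner ℝ b x → b ≠ a → 0 < inner ℝ (orthReflection a b) x
  generates : ∀ a ∈ Φ, orthReflection a ∈ Subgroup.closure (orthReflection '' D)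

namespace IsUnitRootSystem

variable {Φ : Set E} (hΦ : IsUnitRootSystem Φ)

include hΦ

theorem neg_mem {a : E} (ha : a ∈ Φ) : -a ∈ Φ := by
  have h := hΦ.reflection_mem a ha a ha
  rwa [orthReflection_apply_of_norm_eq_one (hΦ.norm_eq_one a ha), real_inner_self_eq_norm_sq,
    hΦ.norm_eq_one a ha, show a - (2 * 1 ^ 2 : ℝ) • a = -a by module] at h

theorem closure_apply_mem {w : E ≃ₗᵢ[ℝ] E} {D : Set E} (hD : D ⊆ Φ)
    (hw : w ∈ Subgroup.closure (orthReflection '' D)) {a : E} (ha : a ∈ Φ) : w a ∈ Φ := by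
  induction hw using Subgroup.closure_induction_left generalizing a with
  | one => exact ha
  | mul_left g hg w _ ih =>
    obtain ⟨d, hd, rfl⟩ := hg
    exact hΦ.reflection_mem d (hD hd) _ (ih ha)
  | inv_mul_cancel g hg w _ ih =>
    obtain ⟨d, hd, rfl⟩ := hg
    rw [Submodule.reflection_inv]
    exact hΦ.reflection_mem d (hD hd) _ (ih ha)

theorem exists_isSimpleSystem {x : E} (hx : ∀ a ∈ Φ, inner ℝ a x ≠ 0) :
    ∃ D, IsSimpleSystem Φ x D := by
  classical
  obtain ⟨D, hDP, hcone, hmin⟩ := exists_minimal_cone_generators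
    (hΦ.finite.toFinset.filter fun a => 0 < inner ℝ a x)
  have hDΦ : ∀ a ∈ D, a ∈ Φ := fun a ha => by simpa using (Finset.mem_filter.mp (hDP ha)).1
  have hDpos : ∀ a ∈ D, 0 < inner ℝ a x := fun a ha => (Finset.mem_filter.mp (hDP ha)).2
  have hcone' : ∀ b ∈ Φ, 0 < inner ℝ b x →
      ∃ c : E → ℝ, (∀ d ∈ D, 0 ≤ c d) ∧ b = ∑ d ∈ D, c d • d :=
    fun b hb hbx => hcone b (by simp [hb, hbx])
  have hperm : ∀ a ∈ D, ∀ b ∈ Φ, 0 < inner ℝ b x → b ≠ a →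
      0 < inner ℝ (orthReflection a b) x := by
    intro a ha b hb hbx hba
    by_contra hneg
    have hr := hΦ.reflection_mem a (hDΦ a ha) b hb
    have hneg' : 0 < inner ℝ (-orthReflection a b) x := by
      rw [inner_neg_left]
      have := lt_of_le_of_ne (not_lt.mp hneg) (hx _ hr)
      linarith
    obtain ⟨c, hc, hbc⟩ := hcone' b hb hbx
    obtain ⟨e, he, hbe⟩ := hcone' _ (hΦ.neg_mem hr) hneg'
    have hsplit : ∀ c : E → ℝ, ∑ d ∈ D, c d • d = c a • a + ∑ d ∈ D with d ≠ a, c d • d :=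
      fun c => by rw [Finset.filter_ne', Finset.add_sum_erase D (fun d => c d • d) ha]
    have hsum : ∑ d ∈ D with d ≠ a, (c d + e d) • d =
        (2 * inner ℝ a b - c a - e a) • a := by
      rw [orthReflection_apply_of_norm_eq_one (hΦ.norm_eq_one a (hDΦ a ha))] at hbe
      have hbc' := hbc
      rw [hsplit] at hbe hbc'
      have e1 : ∑ d ∈ D with d ≠ a, c d • d = b - c a • a := by
        rw [eq_sub_iff_add_eq', ← hbc']
      have e2 : ∑ d ∈ D with d ≠ a, e d • d = -(b - (2 * inner ℝ a b) • a) - e a • a := by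
        rw [eq_sub_iff_add_eq', ← hbe]
      simp only [add_smul, Finset.sum_add_distrib, e1, e2]
      module
    set μ := 2 * inner ℝ a b - c a - e a
    have hterm : ∀ d ∈ D.filter (· ≠ a), 0 ≤ (c d + e d) * inner ℝ d x := fun d hd =>
      mul_nonneg (add_nonneg (hc d (Finset.mem_filter.mp hd).1) (he d (Finset.mem_filter.mp hd).1))
        (hDpos d (Finset.mem_filter.mp hd).1).le
    have hinner : ∑ d ∈ D with d ≠ a, (c d + e d) * inner ℝ d x = μ * inner ℝ a x := by
      rw [← real_inner_smul_left, ← hsum, sum_inner]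
      exact Finset.sum_congr rfl fun d _ => (real_inner_smul_left _ _ _).symm
    have hμ : 0 ≤ μ := by
      have := Finset.sum_nonneg hterm
      rw [hinner] at this
      exact nonneg_of_mul_nonneg_left this (hDpos a ha)
    rcases hμ.eq_or_lt with h0 | hpos
    · rw [← h0, zero_mul, Finset.sum_eq_zero_iff_of_nonneg hterm] at hinner
      have hc0 : ∀ d ∈ D.filter (· ≠ a), c d • d = 0 := by
        intro d hd
        have hdD := (Finset.mem_filter.mp hd).1
        have h1 := (mul_eq_zero.mp (hinner d hd)).resolve_right (hDpos d hdD).ne'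
        have h2 := hc d hdD
        have h3 := he d hdD
        rw [show c d = 0 by linarith, zero_smul]
      rw [hsplit, Finset.sum_eq_zero hc0, add_zero] at hbc
      have hn := hΦ.norm_eq_one b hb
      rw [hbc, norm_smul, hΦ.norm_eq_one a (hDΦ a ha), mul_one, Real.norm_of_nonneg (hc a ha)] at hn
      rw [hn, one_smul] at hbc
      exact hba hbc
    · refine hmin a ha (fun d => μ⁻¹ * (c d + e d))
        (fun d hd => mul_nonneg (inv_nonneg.mpr hμ) (add_nonneg (hc d hd) (he d hd))) ?_
      simp only [mul_smul, ← Finset.smul_sum]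
      rw [hsum, smul_smul, inv_mul_cancel₀ hpos.ne', one_smul]
  refine ⟨D, hDΦ, hDpos, hperm, ?_⟩
  set N := Subgroup.closure (orthReflection '' (D : Set E)) with hN
  have hDN : ∀ a ∈ D, orthReflection a ∈ N := fun a ha => Subgroup.subset_closure ⟨a, ha, rfl⟩
  have hgen : ∀ b ∈ Φ, 0 < inner ℝ b x → orthReflection b ∈ N := by
    intro b hb hbx
    obtain ⟨γ, ⟨hγΦ, hγx, u, hu, hγ⟩, hγmin⟩ := Set.exists_min_image
      {γ | γ ∈ Φ ∧ 0 < inner ℝ γ x ∧ ∃ u ∈ N, γ = u b} (fun γ => inner ℝ γ x)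
      (hΦ.finite.subset fun γ hγ => hγ.1) ⟨b, hb, hbx, 1, one_mem N, rfl⟩
    have hγD : γ ∈ D := by
      by_contra hγD
      obtain ⟨c, hc, hγc⟩ := hcone' γ hγΦ hγx
      have hsum : 0 < ∑ d ∈ D, c d * inner ℝ d γ := by
        have : ∑ d ∈ D, c d * inner ℝ d γ = inner ℝ γ γ := by
          conv_rhs => rw [hγc, sum_inner]
          refine Finset.sum_congr rfl fun d _ => ?_
          rw [real_inner_smul_left, ← hγc]
        rw [this, real_inner_self_eq_norm_sq, hΦ.norm_eq_one γ hγΦ]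
        norm_num
      obtain ⟨d, hd, hpos⟩ : ∃ d ∈ D, 0 < c d * inner ℝ d γ := by
        by_contra! h
        exact absurd (Finset.sum_nonpos h) (not_le.mpr hsum)
      have hdγ : 0 < inner ℝ d γ := pos_of_mul_pos_right hpos (hc d hd)
      have hne : γ ≠ d := by
        rintro rfl
        exact hγD hd
      have hle := hγmin (orthReflection d γ) ⟨hΦ.reflection_mem d (hDΦ d hd) γ hγΦ,
        hperm d hd γ hγΦ hγx hne, orthReflection d * u, mul_mem (hDN d hd) hu, by rw [hγ]; rfl⟩
      rw [orthReflection_apply_of_norm_eq_one (hΦ.norm_eq_one d (hDΦ d hd)), inner_sub_left,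
        real_inner_smul_left] at hle
      have := mul_pos hdγ (hDpos d hd)
      linarith
    have hconj : orthReflection b = u⁻¹ * orthReflection γ * u := by
      rw [hγ, orthReflection_map]
      group
    rw [hconj]
    exact mul_mem (mul_mem (inv_mem hu) (hDN γ hγD)) hu
  intro b hb
  rcases lt_or_gt_of_ne (hx b hb) with h | h
  · rw [← orthReflection_smul (c := -1) (by norm_num) b, neg_one_smul]
    exact hgen (-b) (hΦ.neg_mem hb) (by rw [inner_neg_left]; linarith)
  · exact hgen b hb h

/-- The exchange condition for words in the simple reflections. -/
theorem exchange {x : E} (hx : ∀ a ∈ Φ, inner ℝ a x ≠ 0) {D : Set E} (hD : IsSimpleSystem Φ x D)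
    {a : E} (ha : a ∈ D) (L : List E) (hL : ∀ d ∈ L, d ∈ D)
    (hneg : inner ℝ ((L.map orthReflection).prod a) x < 0) :
    ∃ L' : List E, (∀ d ∈ L', d ∈ D) ∧ L'.length + 1 = L.length ∧
      (L.map orthReflection).prod * orthReflection a = (L'.map orthReflection).prod := by
  induction L with
  | nil =>
    have := hD.pos a ha
    simp only [List.map_nil, List.prod_nil, LinearIsometryEquiv.coe_one, id] at hneg
    linarith
  | cons d L ih =>
    have hL' : ∀ d ∈ L, d ∈ D := fun e he => hL e (List.mem_cons_of_mem _ he)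
    have hdD : d ∈ D := hL d List.mem_cons_self
    set w := (L.map orthReflection).prod with hw
    have hwmem : w ∈ Subgroup.closure (orthReflection '' D) := by
      refine Subgroup.list_prod_mem _ fun g hg => ?_
      obtain ⟨e, he, rfl⟩ := List.mem_map.mp hg
      exact Subgroup.subset_closure ⟨e, hL' e he, rfl⟩
    have hwa : w a ∈ Φ := hΦ.closure_apply_mem hD.subset hwmem (hD.subset ha)
    rw [List.map_cons, List.prod_cons, ← hw] at hneg ⊢
    rcases lt_or_gt_of_ne (hx _ hwa) with h | h
    · obtain ⟨L', h1, h2, h3⟩ := ih hL' h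
      refine ⟨d :: L', ?_, by simp [h2], ?_⟩
      · simpa [hdD] using h1
      · rw [List.map_cons, List.prod_cons, mul_assoc, h3]
    · have hwad : w a = d := by
        by_contra hne
        exact absurd (hD.permutes d hdD (w a) hwa h hne) (not_lt.mpr hneg.le)
      refine ⟨L, hL', by simp, ?_⟩
      rw [← hw, ← hwad, orthReflection_map]
      simp only [mul_assoc, inv_mul_cancel_left]
      rw [orthReflection_mul_self, mul_one]

/-- A finite reflection group acts freely on the complement of its mirrors. -/
theorem eq_one_of_apply_eq {x : E} (hx : ∀ a ∈ Φ, inner ℝ a x ≠ 0) {w : E ≃ₗᵢ[ℝ] E}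
    (hw : w ∈ Subgroup.closure (orthReflection '' Φ)) (hwx : w x = x) : w = 1 := by
  obtain ⟨D, hD⟩ := hΦ.exists_isSimpleSystem hx
  have hwD : w ∈ Subgroup.closure (orthReflection '' D) := by
    refine (Subgroup.closure_le _).mpr ?_ hw
    rintro _ ⟨a, ha, rfl⟩
    exact hD.generates a ha
  have hex : ∃ k, ∃ L : List E, L.length = k ∧ (∀ d ∈ L, d ∈ D) ∧
      w = (L.map orthReflection).prod := by
    suffices ∃ L : List E, (∀ d ∈ L, d ∈ D) ∧ w = (L.map orthReflection).prod by
      obtain ⟨L, h⟩ := this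
      exact ⟨_, L, rfl, h⟩
    have cons : ∀ d ∈ D, ∀ u : E ≃ₗᵢ[ℝ] E,
        (∃ L : List E, (∀ d ∈ L, d ∈ D) ∧ u = (L.map orthReflection).prod) →
        ∃ L : List E, (∀ d ∈ L, d ∈ D) ∧ orthReflection d * u = (L.map orthReflection).prod := by
      rintro d hd u ⟨L, h1, h2⟩
      exact ⟨d :: L, by simpa [hd] using h1, by rw [h2, List.map_cons, List.prod_cons]⟩
    clear hwx hw
    induction hwD using Subgroup.closure_induction_left with
    | one => exact ⟨[], by simp, by simp⟩
    | mul_left g hg u _ ih =>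
      obtain ⟨d, hd, rfl⟩ := hg
      exact cons d hd u ih
    | inv_mul_cancel g hg u _ ih =>
      obtain ⟨d, hd, rfl⟩ := hg
      rw [Submodule.reflection_inv]
      exact cons d hd u ih
  classical
  obtain ⟨L, hlen, hLD, hL⟩ := Nat.find_spec hex
  rcases List.eq_nil_or_concat L with rfl | ⟨L', a, rfl⟩
  · simpa using hL
  exfalso
  have haD : a ∈ D := hLD a (by simp)
  have hL'D : ∀ d ∈ L', d ∈ D := fun d hd => hLD d (by simp [hd])
  rw [List.concat_eq_append, List.map_append, List.prod_append, List.map_singleton,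
    List.prod_singleton] at hL
  set u := (L'.map orthReflection).prod with hu
  have humem : u ∈ Subgroup.closure (orthReflection '' D) := by
    refine Subgroup.list_prod_mem _ fun g hg => ?_
    obtain ⟨e, he, rfl⟩ := List.mem_map.mp hg
    exact Subgroup.subset_closure ⟨e, hL'D e he, rfl⟩
  rcases lt_or_gt_of_ne (hx _ (hΦ.closure_apply_mem hD.subset humem (hD.subset haD))) with h | h
  · obtain ⟨L'', h1, h2, h3⟩ := hΦ.exchange hx hD haD L' hL'D h
    refine Nat.find_min hex (m := L''.length) ?_ ⟨L'', rfl, h1, by rw [hL, h3]⟩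
    rw [← hlen, List.length_concat]
    omega
  · have hwa : w a = -u a := by
      rw [hL]
      change u (orthReflection a a) = _
      rw [orthReflection, Submodule.reflection_orthogonalComplement_singleton_eq_neg, map_neg]
    have h1 := w.inner_map_map a x
    rw [hwx, hwa, inner_neg_left] at h1
    have h2 := hD.pos a haD
    linarith

end IsUnitRootSystem

end ReflectionGroup

/-- The fixed subspace of a linear map. -/
def fixedSpace {E : Type*} [AddCommGroup E] [Module ℝ E] (f : E ≃ₗ[ℝ] E) : Submodule ℝ E :=
  LinearMap.eqLocus f.toLinearMap LinearMap.id

theorem mem_fixedSpace {E : Type*} [AddCommGroup E] [Module ℝ E] {f : E ≃ₗ[ℝ] E} {v : E} :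
    v ∈ fixedSpace f ↔ f v = v := Iff.rfl

theorem finrank_le_finrank_inf_ker_add_one {E : Type*} [AddCommGroup E] [Module ℝ E]
    [FiniteDimensional ℝ E] (F : Submodule ℝ E) (φ : E →ₗ[ℝ] ℝ) :
    Module.finrank ℝ F ≤ Module.finrank ℝ (F ⊓ LinearMap.ker φ : Submodule ℝ E) + 1 := by
  have h := LinearMap.finrank_range_add_finrank_ker (φ.domRestrict F)
  have h1 : Module.finrank ℝ (LinearMap.range (φ.domRestrict F)) ≤ 1 := by
    simpa using Submodule.finrank_le (LinearMap.range (φ.domRestrict F))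
  have h2 : Module.finrank ℝ (LinearMap.ker (φ.domRestrict F)) =
      Module.finrank ℝ (F ⊓ LinearMap.ker φ : Submodule ℝ E) := by
    rw [LinearMap.ker_domRestrict]
    have e := (Submodule.equivSubtypeMap F ((LinearMap.ker φ).comap F.subtype)).finrank_eq
    rw [Submodule.map_comap_subtype] at e
    exact e
  omega

section LinearReflections

variable {ι W E : Type*} [Group W] [AddCommGroup E] [Module ℝ E] {M : CoxeterMatrix ι}
  (cs : CoxeterSystem M W) {ρ : W →* (E ≃ₗ[ℝ] E)} {f : ι → E →ₗ[ℝ] ℝ} {a : ι → E}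

/-- If the roots are linearly independent, then the product of distinct reflections fixes only
the intersection of their mirrors. -/
theorem CoxeterSystem.form_eq_zero_of_wordProd_apply_eq
    (hρ : ∀ i v, ρ (cs.simple i) v = v - f i v • a i) (ha : LinearIndependent ℝ a)
    {L : List ι} (hL : L.Nodup) {v : E} (hv : ρ (cs.wordProd L) v = v) :
    ∀ i ∈ L, f i v = 0 := by
  have hspan : ∀ (L : List ι) (v : E),
      ρ (cs.wordProd L) v - v ∈ Submodule.span ℝ (a '' {i | i ∈ L}) := by
    intro L v
    induction L with
    | nil => simp
    | cons i L ih =>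
      rw [cs.wordProd_cons, map_mul, LinearEquiv.mul_apply, hρ]
      have hsub : a '' {j | j ∈ L} ⊆ a '' {j | j ∈ i :: L} :=
        Set.image_mono fun j hj => List.mem_cons_of_mem _ hj
      have hi : a i ∈ Submodule.span ℝ (a '' {j | j ∈ i :: L}) :=
        Submodule.subset_span ⟨i, List.mem_cons_self, rfl⟩
      have := sub_mem (Submodule.span_mono hsub ih)
        (Submodule.smul_mem _ (f i (ρ (cs.wordProd L) v)) hi)
      convert this using 1
      abel
  induction L with
  | nil => simp
  | cons i L ih =>
    obtain ⟨hiL, hL'⟩ := List.nodup_cons.mp hL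
    have h1 : ρ (cs.wordProd L) v = v - f i v • a i := by
      have e : cs.wordProd L = cs.simple i * cs.wordProd (i :: L) := by
        rw [cs.wordProd_cons, cs.simple_mul_simple_cancel_left]
      rw [e, map_mul, LinearEquiv.mul_apply, hv, hρ]
    have h2 := hspan L v
    rw [h1, sub_sub_cancel_left, neg_mem_iff] at h2
    have h0 : f i v = 0 := by
      by_contra hne
      refine ha.notMem_span_image (s := {j | j ∈ L}) hiL ?_
      exact (Submodule.smul_mem_iff _ hne).mp h2
    rw [h0, zero_smul, sub_zero] at h1
    intro j hj
    rcases List.mem_cons.mp hj with rfl | hj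
    · exact h0
    · exact ih hL' h1 j hj

theorem CoxeterSystem.IsReflection.exists_apply_eq {cs : CoxeterSystem M W}
    (hρ : ∀ i v, ρ (cs.simple i) v = v - f i v • a i) {t : W} (ht : cs.IsReflection t) :
    ∃ (φ : E →ₗ[ℝ] ℝ) (b : E), ∀ v, ρ t v = v - φ v • b := by
  obtain ⟨w, i, rfl⟩ := ht
  refine ⟨(f i).comp (ρ w⁻¹).toLinearMap, ρ w (a i), fun v => ?_⟩
  rw [map_mul, map_mul, LinearEquiv.mul_apply, LinearEquiv.mul_apply, hρ, map_sub, map_smul,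
    ← LinearEquiv.mul_apply, ← map_mul, mul_inv_cancel, map_one]
  rfl

theorem CoxeterSystem.finrank_le_finrank_fixedSpace_add_length [FiniteDimensional ℝ E]
    (hρ : ∀ i v, ρ (cs.simple i) v = v - f i v • a i) (L : List W)
    (hL : ∀ t ∈ L, cs.IsReflection t) :
    Module.finrank ℝ E ≤ Module.finrank ℝ (fixedSpace (ρ L.prod)) + L.length := by
  induction L with
  | nil =>
    have : fixedSpace (ρ ([] : List W).prod) = ⊤ := by
      ext v
      simp [mem_fixedSpace]
    rw [this, finrank_top]
    simp
  | cons t L ih =>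
    obtain ⟨φ, b, hφ⟩ := (hL t List.mem_cons_self).exists_apply_eq hρ
    have h1 := ih fun s hs => hL s (List.mem_cons_of_mem _ hs)
    have h2 := finrank_le_finrank_inf_ker_add_one (fixedSpace (ρ L.prod)) φ
    have h3 : fixedSpace (ρ L.prod) ⊓ LinearMap.ker φ ≤ fixedSpace (ρ (t :: L).prod) := by
      rintro v ⟨hv, hφv⟩
      have hv' : ρ L.prod v = v := hv
      have hφv' : φ v = 0 := hφv
      rw [mem_fixedSpace, List.prod_cons, map_mul, LinearEquiv.mul_apply, hv', hφ, hφv', zero_smul,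
        sub_zero]
    have h4 := Submodule.finrank_mono h3
    rw [List.length_cons]
    omega

end LinearReflections

section Orthogonal

variable {E : Type*} [NormedAddCommGroup E] [InnerProductSpace ℝ E] [FiniteDimensional ℝ E]

/-- The fixed space of `w` is strictly enlarged by a reflection that fixes it pointwise. -/
theorem finrank_fixedSpace_lt_of_reflection {w : E ≃ₗᵢ[ℝ] E} {b : E} (hb : b ≠ 0)
    (hfix : ∀ v, w v = v → orthReflection b v = v) :
    Module.finrank ℝ (fixedSpace w.toLinearEquiv) <
      Module.finrank ℝ (fixedSpace (orthReflection b * w).toLinearEquiv) := by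
  have hmem : b ∈ LinearMap.range (w.toLinearEquiv.toLinearMap - LinearMap.id) := by
    rw [← Submodule.orthogonal_orthogonal (LinearMap.range _), Submodule.mem_orthogonal]
    intro v hv
    rw [Submodule.mem_orthogonal] at hv
    have h : ∀ u, inner ℝ (w u - u) v = 0 := fun u => hv _ ⟨u, rfl⟩
    have hwv : w v = v := by
      rw [← sub_eq_zero, ← inner_self_eq_zero (𝕜 := ℝ)]
      have h1 := h v
      rw [inner_sub_left, sub_eq_zero] at h1
      rw [inner_sub_left, inner_sub_right, inner_sub_right, w.inner_map_map,
        real_inner_comm (w v) v, h1]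
      ring
    rw [real_inner_comm]
    exact orthReflection_apply_eq_self_iff.mp (hfix v hwv)
  obtain ⟨u, hu⟩ := hmem
  have hu' : w u - u = b := hu
  apply Submodule.finrank_lt_finrank_of_lt
  rw [SetLike.lt_iff_le_and_exists]
  refine ⟨fun v hv => ?_, u, ?_, ?_⟩
  · have hv' : w v = v := hv
    change orthReflection b (w v) = v
    rw [hv', hfix v hv']
  · change orthReflection b (w u) = u
    rw [← hu']
    exact Submodule.reflection_sub (w.norm_map u)
  · intro h
    have h' : w u = u := h
    rw [h', sub_self] at hu'
    exact hb hu'.symm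

end Orthogonal

namespace FiniteCoxeterReflectionGroup

variable {n : ℕ} (G : FiniteCoxeterReflectionGroup n)

/-- The given representation of the group, by linear automorphisms. -/
def linRep : G.W →* (EuclideanSpace ℝ (Fin n) ≃ₗ[ℝ] EuclideanSpace ℝ (Fin n)) where
  toFun w := (w : OrthGroup n).toLinearEquiv
  map_one' := rfl
  map_mul' _ _ := rfl

theorem linRep_apply (w : G.W) (v : EuclideanSpace ℝ (Fin n)) :
    G.linRep w v = (w : OrthGroup n) v := rfl

theorem coe_simple (i : Fin n) : (G.cs.simple i : OrthGroup n) = orthReflection (G.normal i) :=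
  G.simple_eq i

/-- The unit normals of the mirrors of the reflections in the group. -/
def roots : Set (EuclideanSpace ℝ (Fin n)) :=
  Set.range fun p : G.W × Fin n => (p.1 : OrthGroup n) (‖G.normal p.2‖⁻¹ • G.normal p.2)

theorem orthReflection_root (w : G.W) (i : Fin n) :
    orthReflection ((w : OrthGroup n) (‖G.normal i‖⁻¹ • G.normal i)) =
      ((w * G.cs.simple i * w⁻¹ : G.W) : OrthGroup n) := by
  rw [orthReflection_map, orthReflection_smul (by simpa using G.normal_ne_zero i), ← G.coe_simple]
  rfl

theorem isUnitRootSystem_roots : IsUnitRootSystem G.roots where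
  finite := by
    have := G.finite
    exact Set.finite_range _
  norm_eq_one := by
    rintro _ ⟨⟨w, i⟩, rfl⟩
    have := G.normal_ne_zero i
    simp [norm_smul, this]
  reflection_mem := by
    rintro _ ⟨⟨w, i⟩, rfl⟩ _ ⟨⟨u, j⟩, rfl⟩
    simp only
    rw [orthReflection_root]
    exact ⟨(w * G.cs.simple i * w⁻¹ * u, j), rfl⟩

theorem coe_mem_closure_roots (w : G.W) :
    (w : OrthGroup n) ∈ Subgroup.closure (orthReflection '' G.roots) := by
  induction w using G.cs.simple_induction_left with
  | one => exact one_mem _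
  | mul_simple_left w i ih =>
    rw [Subgroup.coe_mul]
    refine mul_mem (Subgroup.subset_closure ⟨_, ⟨(1, i), rfl⟩, ?_⟩) ih
    simp only
    rw [orthReflection_root]
    simp

theorem exists_root_of_isReflection {t : G.W} (ht : G.cs.IsReflection t) :
    ∃ b, b ≠ 0 ∧ (t : OrthGroup n) = orthReflection b := by
  obtain ⟨w, i, rfl⟩ := ht
  refine ⟨_, ?_, (G.orthReflection_root w i).symm⟩
  simpa using G.normal_ne_zero i

/-- A nontrivial element of the group has its fixed space contained in a mirror. -/
theorem exists_isReflection_fixing {w : G.W} (hw : w ≠ 1) :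
    ∃ t, G.cs.IsReflection t ∧
      ∀ v, (w : OrthGroup n) v = v → (t : OrthGroup n) v = v := by
  by_contra! hcon
  apply hw
  let F := fixedSpace (G.linRep w)
  have := G.isUnitRootSystem_roots.finite.to_subtype
  let p : G.roots → Submodule ℝ F := fun b =>
    (Submodule.span ℝ {(b : EuclideanSpace ℝ (Fin n))})ᗮ.comap F.subtype
  have hp : ¬ (⋃ b, (p b : Set F)) = Set.univ := by
    intro hcov
    obtain ⟨⟨_, ⟨u, i⟩, rfl⟩, hb⟩ := Subspace.exists_eq_top_of_iUnion_eq_univ hcov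
    obtain ⟨v, hv, hne⟩ := hcon _ ⟨u, i, rfl⟩
    apply hne
    have hmem : (⟨v, hv⟩ : F) ∈ p ⟨_, ⟨u, i⟩, rfl⟩ := by
      rw [hb]
      trivial
    rw [← orthReflection_root]
    exact (Submodule.reflection_eq_self_iff _).mpr hmem
  obtain ⟨⟨x, hxF⟩, hx⟩ := (Set.ne_univ_iff_exists_notMem _).mp hp
  refine Subtype.ext (G.isUnitRootSystem_roots.eq_one_of_apply_eq (x := x) (fun b hb h0 => ?_)
    (G.coe_mem_closure_roots w) hxF)
  refine hx (Set.mem_iUnion.mpr ⟨⟨b, hb⟩, ?_⟩)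
  exact (Submodule.mem_orthogonal_singleton_iff_inner_right).mpr h0

/-- Carter's lemma: an element is a product of as many reflections as the codimension of its
fixed space, each of them fixing that space. -/
theorem exists_reflection_factorization (w : G.W) :
    ∃ L : List G.W, w = L.prod ∧
      L.length + Module.finrank ℝ (fixedSpace (G.linRep w)) ≤ n ∧
      ∀ t ∈ L, G.cs.IsReflection t ∧
        ∀ v, (w : OrthGroup n) v = v → (t : OrthGroup n) v = v := by
  have hle : ∀ w : G.W, Module.finrank ℝ (fixedSpace (G.linRep w)) ≤ n := fun w => by
    simpa using Submodule.finrank_le (fixedSpace (G.linRep w))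
  induction hd : n - Module.finrank ℝ (fixedSpace (G.linRep w)) using Nat.strong_induction_on
    generalizing w with
  | _ d ih =>
  subst hd
  rcases eq_or_ne w 1 with rfl | hw
  · exact ⟨[], rfl, by simpa using hle 1, by simp⟩
  obtain ⟨t, ht, hfix⟩ := G.exists_isReflection_fixing hw
  obtain ⟨b, hb, htb⟩ := G.exists_root_of_isReflection ht
  have hlt : Module.finrank ℝ (fixedSpace (G.linRep w)) <
      Module.finrank ℝ (fixedSpace (G.linRep (t * w))) := by
    have := finrank_fixedSpace_lt_of_reflection hb (w := (w : OrthGroup n))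
      (by rwa [htb] at hfix)
    rw [← htb] at this
    exact this
  have hle' := hle (t * w)
  obtain ⟨L, hL, hlen, hLt⟩ := ih _ (by omega) (t * w) rfl
  refine ⟨t :: L, ?_, ?_, ?_⟩
  · rw [List.prod_cons, ← hL, ← mul_assoc, ht.mul_self, one_mul]
  · rw [List.length_cons]
    omega
  · intro s hs
    rcases List.mem_cons.mp hs with rfl | hs
    · exact ⟨ht, hfix⟩
    · refine ⟨(hLt s hs).1, fun v hv => (hLt s hs).2 v ?_⟩
      change (t : OrthGroup n) ((w : OrthGroup n) v) = v
      rw [hv, hfix v hv]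

/-- Fixed spaces in the geometric representation are at least as large as in the given one. -/
theorem finrank_fixedSpace_linRep_le_geomRep (w : G.W) :
    Module.finrank ℝ (fixedSpace (G.linRep w)) ≤
      Module.finrank ℝ (fixedSpace (G.cs.geomRep w)) := by
  obtain ⟨L, hL, hlen, hLt⟩ := G.exists_reflection_factorization w
  have h := G.cs.finrank_le_finrank_fixedSpace_add_length (ρ := G.cs.geomRep)
    (f := fun i => (2 : ℝ) • G.M.geomForm i) (a := fun i => Pi.single i 1)
    (fun i v => by simpa using G.cs.geomRep_simple i v) L fun t ht => (hLt t ht).1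
  rw [← hL, Module.finrank_fin_fun] at h
  omega

theorem geomForm_eq_zero_of_wordProd_apply_eq {L : List (Fin n)} (hL : L.Nodup)
    {y : Fin n → ℝ} (hy : G.cs.geomRep (G.cs.wordProd L) y = y) :
    ∀ i ∈ L, G.M.geomForm i y = 0 := by
  have h := G.cs.form_eq_zero_of_wordProd_apply_eq (ρ := G.cs.geomRep)
    (f := fun i => (2 : ℝ) • G.M.geomForm i) (a := fun i => Pi.single i 1)
    (fun i v => by simpa using G.cs.geomRep_simple i v)
    (Pi.linearIndependent_single_one (Fin n) ℝ) hL hy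
  intro i hi
  simpa using h i hi

theorem wordProd_apply_eq_of_inner_eq_zero {L : List (Fin n)} {x : EuclideanSpace ℝ (Fin n)}
    (hx : ∀ i ∈ L, inner ℝ (G.normal i) x = 0) :
    (G.cs.wordProd L : OrthGroup n) x = x := by
  induction L with
  | nil => simp
  | cons i L ih =>
    rw [G.cs.wordProd_cons, Subgroup.coe_mul]
    change (G.cs.simple i : OrthGroup n) ((G.cs.wordProd L : OrthGroup n) x) = x
    rw [ih fun j hj => hx j (List.mem_cons_of_mem _ hj), coe_simple,
      orthReflection_apply_eq_self_iff]
    exact hx i List.mem_cons_self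

/-- The mirrors of the simple reflections meet only in the origin. -/
theorem eq_zero_of_inner_normal_eq_zero {x : EuclideanSpace ℝ (Fin n)}
    (hx : ∀ i, inner ℝ (G.normal i) x = 0) : x = 0 := by
  by_contra hne
  have := G.finite
  set c := G.cs.wordProd (List.finRange n)
  have hc : x ∈ fixedSpace (G.linRep c) :=
    G.wordProd_apply_eq_of_inner_eq_zero fun i _ => hx i
  have hpos : 0 < Module.finrank ℝ (fixedSpace (G.linRep c)) := by
    rw [Module.finrank_pos_iff_exists_ne_zero]
    exact ⟨⟨x, hc⟩, by simpa [Subtype.ext_iff] using hne⟩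
  have hpos' := hpos.trans_le (G.finrank_fixedSpace_linRep_le_geomRep c)
  obtain ⟨⟨y, hy⟩, hy0⟩ := Module.finrank_pos_iff_exists_ne_zero.mp hpos'
  apply hy0
  rw [Subtype.ext_iff]
  exact G.cs.eq_zero_of_geomForm_eq_zero y fun i =>
    G.geomForm_eq_zero_of_wordProd_apply_eq (List.nodup_finRange n) hy i (List.mem_finRange i)

theorem linearIndependent_normal : LinearIndependent ℝ G.normal := by
  refine linearIndependent_of_top_le_span_of_card_eq_finrank ?_ (by simp)
  rw [top_le_iff, ← Submodule.orthogonal_eq_bot_iff, Submodule.eq_bot_iff]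
  intro x hx
  refine G.eq_zero_of_inner_normal_eq_zero fun i => ?_
  exact (Submodule.mem_orthogonal _ _).mp hx _ (Submodule.subset_span ⟨i, rfl⟩)

theorem mem_facet {I : Finset (Fin n)} {j : Fin n} (hI : ∀ i, i ∈ I ↔ i ≠ j)
    {x : EuclideanSpace ℝ (Fin n)} :
    x ∈ G.facet I ↔ (∀ i, i ≠ j → inner ℝ (G.normal i) x = 0) ∧ 0 < inner ℝ (G.normal j) x := by
  classical
  rw [facet, Set.mem_iInter]
  have hmirror : ∀ i, x ∈ mirror (G.normal i) ↔ inner ℝ (G.normal i) x = 0 := fun i =>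
    Submodule.mem_orthogonal_singleton_iff_inner_right
  constructor
  · intro h
    refine ⟨fun i hi => ?_, ?_⟩
    · have := h i
      rw [if_pos ((hI i).mpr hi)] at this
      exact (hmirror i).mp this
    · have := h j
      rw [if_neg (by simp [hI])] at this
      exact this
  · rintro ⟨h1, h2⟩ i
    rcases eq_or_ne i j with rfl | hi
    · rw [if_neg (by simp [hI])]
      exact h2
    · rw [if_pos ((hI i).mpr hi)]
      exact (hmirror i).mpr (h1 i hi)

theorem exists_inner_normal_eq_single (j : Fin n) : ∃ x : EuclideanSpace ℝ (Fin n),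
    (∀ i, i ≠ j → inner ℝ (G.normal i) x = 0) ∧ inner ℝ (G.normal j) x = 1 := by
  let T : EuclideanSpace ℝ (Fin n) →ₗ[ℝ] (Fin n → ℝ) :=
    LinearMap.pi fun i => (innerSL ℝ (G.normal i)).toLinearMap
  have hT : ∀ x i, T x i = inner ℝ (G.normal i) x := fun x i => rfl
  have hinj : Function.Injective T := by
    rw [injective_iff_map_eq_zero]
    intro x hx
    exact G.eq_zero_of_inner_normal_eq_zero fun i => by rw [← hT, hx]; rfl
  obtain ⟨x, hx⟩ := (LinearMap.injective_iff_surjective_of_finrank_eq_finrank (by simp)).mp hinj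
    (Pi.single j 1)
  refine ⟨x, fun i hi => ?_, ?_⟩
  · rw [← hT, hx, Pi.single_eq_of_ne hi]
  · rw [← hT, hx, Pi.single_eq_same]

/-- A reflection fixing the vertex `x` opposite to `j` lies in the corresponding maximal standard
parabolic subgroup. -/
theorem mem_closure_of_isReflection_of_apply_eq {j : Fin n} {x : EuclideanSpace ℝ (Fin n)}
    (hx : ∀ i, i ≠ j → inner ℝ (G.normal i) x = 0) (hxj : inner ℝ (G.normal j) x = 1)
    {t : G.W} (ht : G.cs.IsReflection t) (htx : (t : OrthGroup n) x = x) :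
    t ∈ Subgroup.closure (G.cs.simple '' {i | i ≠ j}) := by
  have := G.finite
  let L := (List.finRange n).filter (· ≠ j)
  have hLmem : ∀ i, i ∈ L ↔ i ≠ j := fun i => by simp [L]
  have hLnodup : L.Nodup := (List.nodup_finRange n).filter _
  set c := G.cs.wordProd L with hc
  have hcx : (c : OrthGroup n) x = x :=
    G.wordProd_apply_eq_of_inner_eq_zero fun i hi => hx i ((hLmem i).mp hi)
  have hx0 : x ≠ 0 := by
    rintro rfl
    simp at hxj
  have hcfix : ∀ v, (c : OrthGroup n) v = v → v = inner ℝ (G.normal j) v • x := by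
    intro v hv
    have h := G.cs.form_eq_zero_of_wordProd_apply_eq (ρ := G.linRep)
      (f := fun i => (2 / ‖G.normal i‖ ^ 2) • (innerSL ℝ (G.normal i)).toLinearMap) (a := G.normal)
      (fun i v => by
        rw [linRep_apply, coe_simple, orthReflection_apply]
        simp only [LinearMap.smul_apply, ContinuousLinearMap.coe_coe, innerSL_apply_apply,
          smul_eq_mul]
        congr 2
        ring)
      G.linearIndependent_normal hLnodup hv
    rw [← sub_eq_zero]
    refine G.eq_zero_of_inner_normal_eq_zero fun i => ?_
    rw [inner_sub_right, real_inner_smul_right]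
    rcases eq_or_ne i j with rfl | hi
    · rw [hxj]
      ring
    · have hi0 := h i ((hLmem i).mpr hi)
      have hn : ‖G.normal i‖ ≠ 0 := by simpa using G.normal_ne_zero i
      simp only [LinearMap.smul_apply, ContinuousLinearMap.coe_coe, innerSL_apply_apply,
        smul_eq_mul, mul_eq_zero] at hi0
      rw [hx i hi, hi0.resolve_left (by positivity)]
      ring
  obtain ⟨b, hb, htb⟩ := G.exists_root_of_isReflection ht
  have hlt : Module.finrank ℝ (fixedSpace (G.linRep c)) <
      Module.finrank ℝ (fixedSpace (G.linRep (t * c))) := by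
    have := finrank_fixedSpace_lt_of_reflection hb (w := (c : OrthGroup n)) fun v hv => by
      rw [← htb, hcfix v hv, map_smul, htx]
    rw [← htb] at this
    exact this
  have hpos : 0 < Module.finrank ℝ (fixedSpace (G.linRep c)) := by
    rw [Module.finrank_pos_iff_exists_ne_zero]
    exact ⟨⟨x, hcx⟩, by simpa [Subtype.ext_iff] using hx0⟩
  have hgeom := G.finrank_fixedSpace_linRep_le_geomRep (t * c)
  obtain ⟨φ, d, hφ⟩ := ht.exists_apply_eq (ρ := G.cs.geomRep)
    (f := fun i => (2 : ℝ) • G.M.geomForm i) (a := fun i => Pi.single i 1)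
    (fun i v => by simpa using G.cs.geomRep_simple i v)
  have hker := finrank_le_finrank_inf_ker_add_one (fixedSpace (G.cs.geomRep (t * c))) φ
  obtain ⟨⟨y, hy, hφy⟩, hy0⟩ := Module.finrank_pos_iff_exists_ne_zero.mp
    (show 0 < Module.finrank ℝ
      (fixedSpace (G.cs.geomRep (t * c)) ⊓ LinearMap.ker φ : Submodule ℝ (Fin n → ℝ)) by omega)
  have hφy' : φ y = 0 := hφy
  have hty : G.cs.geomRep t y = y := by rw [hφ, hφy', zero_smul, sub_zero]
  have hcy : G.cs.geomRep c y = y := by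
    have hy' : G.cs.geomRep (t * c) y = y := hy
    have e : c = t * (t * c) := by rw [← mul_assoc, ht.mul_self, one_mul]
    rw [e, map_mul, LinearEquiv.mul_apply, hy', hty]
  have hforms := G.geomForm_eq_zero_of_wordProd_apply_eq hLnodup hcy
  have hsum : ∀ v : Fin n → ℝ, ∑ i, v i * G.M.geomForm i y = v j * G.M.geomForm j y := fun v =>
    Finset.sum_eq_single j (fun i _ hi => by rw [hforms i ((hLmem i).mpr hi), mul_zero])
      (by simp)
  have hj : G.M.geomForm j y ≠ 0 := by
    intro h0
    apply hy0
    rw [Subtype.ext_iff]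
    refine G.cs.eq_zero_of_geomForm_eq_zero y fun i => ?_
    rcases eq_or_ne i j with rfl | hi
    · exact h0
    · exact hforms i ((hLmem i).mpr hi)
  refine G.cs.mem_closure_of_geomRep_apply_eq j t fun v => ?_
  have h := G.cs.sum_mul_geomForm_geomRep t v y
  rw [hty, hsum, hsum] at h
  exact mul_right_cancel₀ hj h

end FiniteCoxeterReflectionGroup

theorem mainTheorem6 (n : ℕ) (G : FiniteCoxeterReflectionGroup n) (I : Finset (Fin n))
    (hI : I.card + 1 = n) :
    G.stab (G.facet I) = G.parabolic I := by
  obtain ⟨j, hj⟩ : ∃ j, Iᶜ = {j} := by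
    rw [← Finset.card_eq_one, Finset.card_compl, Fintype.card_fin]
    omega
  have hIj : ∀ i, i ∈ I ↔ i ≠ j := fun i => by
    rw [← not_iff_not, ← Finset.mem_compl, hj]
    simp
  have hset : (I : Set (Fin n)) = {i | i ≠ j} := by
    ext i
    exact hIj i
  obtain ⟨x, hx, hxj⟩ := G.exists_inner_normal_eq_single j
  have hray : ∀ v ∈ G.facet I, ∃ c : ℝ, 0 < c ∧ v = c • x := by
    intro v hv
    obtain ⟨h1, h2⟩ := (G.mem_facet hIj).mp hv
    refine ⟨_, h2, ?_⟩
    rw [← sub_eq_zero]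
    refine G.eq_zero_of_inner_normal_eq_zero fun i => ?_
    rw [inner_sub_right, real_inner_smul_right]
    rcases eq_or_ne i j with rfl | hi
    · rw [hxj]
      ring
    · rw [h1 i hi, hx i hi]
      ring
  have hxC : x ∈ G.facet I := (G.mem_facet hIj).mpr ⟨hx, by rw [hxj]; norm_num⟩
  have hx0 : ‖x‖ ≠ 0 := by
    rw [norm_ne_zero_iff]
    rintro rfl
    simp at hxj
  rw [FiniteCoxeterReflectionGroup.parabolic, hset]
  apply le_antisymm
  · intro w hw
    have hw' : (w : OrthGroup n) '' G.facet I = G.facet I := hw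
    obtain ⟨c, hc, hwc⟩ := hray _ (hw' ▸ Set.mem_image_of_mem (w : OrthGroup n) hxC)
    have hwx : (w : OrthGroup n) x = x := by
      have hn := (w : OrthGroup n).norm_map x
      rw [hwc, norm_smul, Real.norm_of_nonneg hc.le] at hn
      rw [hwc, (mul_eq_right₀ hx0).mp hn, one_smul]
    obtain ⟨L, rfl, -, hL⟩ := G.exists_reflection_factorization w
    exact Subgroup.list_prod_mem _ fun t ht =>
      G.mem_closure_of_isReflection_of_apply_eq hx hxj (hL t ht).1 ((hL t ht).2 x hwx)
  · rw [Subgroup.closure_le]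
    rintro _ ⟨i, hi, rfl⟩
    change (G.cs.simple i : OrthGroup n) '' G.facet I = G.facet I
    have hfix : ∀ v ∈ G.facet I, (G.cs.simple i : OrthGroup n) v = v := by
      intro v hv
      rw [G.coe_simple, orthReflection_apply_eq_self_iff]
      exact ((G.mem_facet hIj).mp hv).1 i hi
    rw [Set.image_congr hfix, Set.image_id']
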